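/- Let $M$ be a smooth manifold of dimension $n+1$ and let $g$ be a smooth Lorentzian metric on $M$, of signature $(-,+,\dots,+)$, with a time orientation, i.e. a continuous assignment of a future cone to each point, so that $(M,g)$ is a spacetime. A nonzero vector $X$ is causal if $g(X,X)\le 0$ and timelike if $g(X,X)<0$. A nontrivial future causal curve is a piecewise smooth curve $\alpha:[a,b]\to M$ all of whose tangents, including one-sided tangents at breaks and endpoints, are (nonzero) future-pointing causal vectors; $x\le y$ means that $x=y$ or that there is such a curve in $M$ from $x$ to $y$. A time function is a continuous function $M\to\mathbb R$ that is strictly increasing along all nontrivial future causal curves. A function $f:M\to\mathbb R$ is locally anti-Lipschitz if each $p\in M$ has a neighborhood $U$ and a (definite) distance function $d_U$ on $U$ such that $x\le y\Rightarrow f(y)-f(x)\ge d_U(x,y)$ for all $x,y\in U$. Write $\|X\|_g=\sqrt{|g(X,X)|}$. Let $\tau:M\to\mathbb R$ be everywhere differentiable, so that its gradient $\nabla\tau$, determined by $g(\nabla\tau,X)=d\tau(X)$ for all $X$, is defined on all of $M$ (but is possibly discontinuous). Let $h$ be any smooth Riemannian metric on $M$, with norm $\|X\|_h=\sqrt{h(X,X)}$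 and induced distance $d_h$. Then the following are equivalent: (a) For each $p\in M$ there are a neighborhood $U$ of $p$ and a constant $C>0$ such that $g(\nabla\tau,X)\ge C\|X\|_h$ for all $q\in U$ and all future-pointing causal vectors $X\in T_qM$. (b) For each $p\in M$ there are a neighborhood $U$ of $p$ and a constant $C>0$ such that $\tau(y)-\tau(x)\ge C\,d_h(x,y)$ for all $x,y\in U$ with $x\le y$. If either of these conditions holds, then $\tau$ is a locally anti-Lipschitz time function, $\nabla\tau$ is past-pointing timelike at every point (that is, $\nabla\tau$ is timelike and $-\nabla\tau$ is future-pointing), and $\|\nabla\tau\|_g$ is locally bounded away from zero: each $p\in M$ has a neighborhood $U$ and a constant $C>0$ with $\|\nabla\tau\|_g\ge C$ on $U$. -/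

import Mathlib

open Set Topology Bundle Manifold
open scoped ContDiff

noncomputable section

namespace NullDistance

/-- A smooth Lorentzian metric, of signature `(-, +, …, +)`, on a manifold `M` of dimension
`n + 1`. -/
structure LorentzianMetric (n : ℕ) (M : Type*) [TopologicalSpace M]
    [ChartedSpace (EuclideanSpace ℝ (Fin (n + 1))) M] [IsManifold (𝓡 (n + 1)) ∞ M] where
  /-- The scalar product `g_p` on `T_pM`. -/
  inner (p : M) : TangentSpace (𝓡 (n + 1)) p →L[ℝ] TangentSpace (𝓡 (n + 1)) p →L[ℝ] ℝ
  symm (p : M) (v w : TangentSpace (𝓡 (n + 1)) p) : inner p v w = inner p w v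
  /-- Each tangent space has a basis `e_0, …, e_n` which is orthonormal, with `e_0` timelike. -/
  signature (p : M) : ∃ e : Module.Basis (Fin (n + 1)) ℝ (TangentSpace (𝓡 (n + 1)) p),
    ∀ i j, inner p (e i) (e j) = if i = j then (if i = 0 then -1 else 1) else 0
  contMDiff : ContMDiff (𝓡 (n + 1))
    ((𝓡 (n + 1)).prod 𝓘(ℝ, EuclideanSpace ℝ (Fin (n + 1)) →L[ℝ]
      EuclideanSpace ℝ (Fin (n + 1)) →L[ℝ] ℝ)) ∞
    (fun p ↦ TotalSpace.mk' (EuclideanSpace ℝ (Fin (n + 1)) →L[ℝ]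
      EuclideanSpace ℝ (Fin (n + 1)) →L[ℝ] ℝ) p (inner p))

/-- A spacetime structure on `M`: a smooth Lorentzian metric together with a time orientation,
i.e. a continuous assignment of a future cone to each point. -/
structure Spacetime (n : ℕ) (M : Type*) [TopologicalSpace M]
    [ChartedSpace (EuclideanSpace ℝ (Fin (n + 1))) M] [IsManifold (𝓡 (n + 1)) ∞ M]
    extends LorentzianMetric n M where
  /-- The set of (nonzero) future-pointing causal vectors at `p`. -/
  future (p : M) : Set (TangentSpace (𝓡 (n + 1)) p)
  /-- Near each point there is a continuous timelike vector field `V` such that the future cone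
  is the one of the two causal cones which contains `V`. -/
  time_oriented (p : M) : ∃ U ∈ 𝓝 p, ∃ V : ∀ q : M, TangentSpace (𝓡 (n + 1)) q,
    ContinuousOn (fun q ↦ (⟨q, V q⟩ : TangentBundle (𝓡 (n + 1)) M)) U ∧
    ∀ q ∈ U, inner q (V q) (V q) < 0 ∧
      future q = {X | X ≠ 0 ∧ inner q X X ≤ 0 ∧ inner q (V q) X < 0}

variable {n : ℕ} {M : Type*} [TopologicalSpace M]
  [ChartedSpace (EuclideanSpace ℝ (Fin (n + 1))) M] [IsManifold (𝓡 (n + 1)) ∞ M]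

namespace LorentzianMetric

/-- `g_p` as a bilinear form on `T_pM`. -/
def bilin (g : LorentzianMetric n M) (p : M) :
    LinearMap.BilinForm ℝ (TangentSpace (𝓡 (n + 1)) p) :=
  LinearMap.mk₂ ℝ (fun v w ↦ g.inner p v w) (by simp) (by simp) (by simp) (by simp)

theorem bilin_apply (g : LorentzianMetric n M) (p : M) (v w : TangentSpace (𝓡 (n + 1)) p) :
    g.bilin p v w = g.inner p v w := rfl

theorem bilin_nondegenerate (g : LorentzianMetric n M) (p : M) : (g.bilin p).Nondegenerate := by
  have hrefl : (g.bilin p).IsRefl := fun v w h ↦ by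
    rw [bilin_apply] at h ⊢
    rw [g.symm, h]
  refine hrefl.nondegenerate_iff_separatingLeft.2 fun v hv ↦ ?_
  obtain ⟨e, he⟩ := g.signature p
  refine e.repr.injective (Finsupp.ext fun j ↦ ?_)
  have h := hv (e j)
  rw [← e.sum_repr v, bilin_apply] at h
  simp only [map_sum, map_smul, sum_apply,
    smul_apply, he, smul_eq_mul, mul_ite, mul_zero,
    Finset.sum_ite_eq', Finset.mem_univ, if_true] at h
  split_ifs at h <;> simpa using h

/-- The gradient at `p` of a function `f` which is differentiable at `p`: the metric dual of
the differential, see `inner_gradient`. -/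
def gradient (g : LorentzianMetric n M) (f : M → ℝ) (p : M) : TangentSpace (𝓡 (n + 1)) p :=
  haveI : FiniteDimensional ℝ (TangentSpace (𝓡 (n + 1)) p) :=
    inferInstanceAs (FiniteDimensional ℝ (EuclideanSpace ℝ (Fin (n + 1))))
  ((g.bilin p).toDual (g.bilin_nondegenerate p)).symm
    (mfderiv (𝓡 (n + 1)) 𝓘(ℝ, ℝ) f p : TangentSpace (𝓡 (n + 1)) p →L[ℝ] ℝ).toLinearMap

theorem inner_gradient (g : LorentzianMetric n M) (f : M → ℝ) (p : M)
    (X : TangentSpace (𝓡 (n + 1)) p) :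
    g.inner p (g.gradient f p) X = mfderiv (𝓡 (n + 1)) 𝓘(ℝ, ℝ) f p X := by
  have : FiniteDimensional ℝ (TangentSpace (𝓡 (n + 1)) p) :=
    inferInstanceAs (FiniteDimensional ℝ (EuclideanSpace ℝ (Fin (n + 1))))
  exact LinearMap.BilinForm.apply_toDual_symm_apply (hB := g.bilin_nondegenerate p)
    (mfderiv (𝓡 (n + 1)) 𝓘(ℝ, ℝ) f p : TangentSpace (𝓡 (n + 1)) p →L[ℝ] ℝ).toLinearMap X

/-- `‖X‖_g = √|g(X, X)|`. -/
def gnorm (g : LorentzianMetric n M) (p : M) (X : TangentSpace (𝓡 (n + 1)) p) : ℝ :=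
  √|g.inner p X X|

end LorentzianMetric

namespace Spacetime

/-- `X` is past-pointing timelike. -/
def IsPastTimelike (g : Spacetime n M) (p : M) (X : TangentSpace (𝓡 (n + 1)) p) : Prop :=
  g.inner p X X < 0 ∧ -X ∈ g.future p

/-- `α : [a, b] → M` is smooth, and all its tangents, including the one-sided tangents at the
endpoints, are (nonzero) future-pointing causal vectors. -/
def IsSmoothFutureCausal (g : Spacetime n M) (α : ℝ → M) (a b : ℝ) : Prop :=
  a < b ∧ ContMDiffOn 𝓘(ℝ, ℝ) (𝓡 (n + 1)) ∞ α (Icc a b) ∧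
    ∀ t ∈ Icc a b, mfderivWithin 𝓘(ℝ, ℝ) (𝓡 (n + 1)) α (Icc a b) t (1 : ℝ) ∈ g.future (α t)

/-- `α : [a, b] → M` is a nontrivial (piecewise smooth, regular) future causal curve: there is a
partition `a = s 0 < s 1 < ⋯ < s k = b`, `k ≥ 1`, on each piece of which `α` is smooth future
causal. -/
def IsFutureCausalCurve (g : Spacetime n M) (α : ℝ → M) (a b : ℝ) : Prop :=
  ∃ (k : ℕ) (s : ℕ → ℝ), 0 < k ∧ s 0 = a ∧ s k = b ∧
    ∀ i < k, g.IsSmoothFutureCausal α (s i) (s (i + 1))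

/-- The causal relation `x ≤ y`: there is a future causal curve, possibly trivial, from `x`
to `y`. -/
def CausallyPrecedes (g : Spacetime n M) (x y : M) : Prop :=
  x = y ∨ ∃ (α : ℝ → M) (a b : ℝ), g.IsFutureCausalCurve α a b ∧ α a = x ∧ α b = y

/-- `τ` is strictly increasing along all nontrivial future causal curves. -/
def IsGeneralizedTimeFunction (g : Spacetime n M) (τ : M → ℝ) : Prop :=
  ∀ (α : ℝ → M) (a b : ℝ), g.IsFutureCausalCurve α a b → StrictMonoOn (τ ∘ α) (Icc a b)

/-- A time function is a continuous generalized time function. -/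
def IsTimeFunction (g : Spacetime n M) (τ : M → ℝ) : Prop :=
  Continuous τ ∧ g.IsGeneralizedTimeFunction τ

/-- Each point has a neighborhood `U` and a (definite) distance function `d_U` on `U` such that
`x ≤ y` implies `f y - f x ≥ d_U x y` for `x, y ∈ U`. The relation `x ≤ y` is that of `M`. -/
def LocallyAntiLipschitz (g : Spacetime n M) (f : M → ℝ) : Prop :=
  ∀ p : M, ∃ U ∈ 𝓝 p, ∃ d : MetricSpace U, ∀ x y : U,
    g.CausallyPrecedes x y → f y - f x ≥ d.dist x y

end Spacetime

/-- A smooth Riemannian metric on `M`. -/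
abbrev RiemMetric (n : ℕ) (M : Type*) [TopologicalSpace M]
    [ChartedSpace (EuclideanSpace ℝ (Fin (n + 1))) M] [IsManifold (𝓡 (n + 1)) ∞ M] :=
  ContMDiffRiemannianMetric (𝓡 (n + 1)) ∞ (EuclideanSpace ℝ (Fin (n + 1)))
    (fun p : M ↦ TangentSpace (𝓡 (n + 1)) p)

/-- `‖X‖_h = √h(X, X)`. -/
def hnorm (h : RiemMetric n M) (p : M) (X : TangentSpace (𝓡 (n + 1)) p) : ℝ :=
  √(h.inner p X X)

/-- The Riemannian distance `d_h`: the infimum of the `h`-lengths of the paths from `x` to `y`.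
(It is used only for points which are joined by a path, where this infimum is finite.) -/
def hdist (h : RiemMetric n M) (x y : M) : ℝ :=
  letI : RiemannianBundle (fun p : M ↦ TangentSpace (𝓡 (n + 1)) p) := ⟨h.toRiemannianMetric⟩
  (riemannianEDist (𝓡 (n + 1)) x y).toReal

end NullDistance

end

/-! Along a future causal curve `α` the derivative of `τ ∘ α` is `g(∇τ, α')`, so (a) says that
locally `τ` grows at least `C` times as fast as `h`-length. This derivative may be discontinuous,
but being nonnegative it is integrable, and the fundamental theorem of calculus gives (b) for curves
that stay in `U`.

The difficulty is that `x ≤ y` refers to curves in all of `M`, which may leave `U`. By (a) at every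
point, `τ` increases along them throughout, and a curve cannot leave the `ρ`-ball around `x` before
`τ` has gained `C * ρ`. So for `x`, `y` close together, either the gain already exceeds `C` times
their distance, or the curve stays where the local bound applies
(`exists_forall_causallyPrecedes_le`). No causality assumption on `M` is needed.

Conversely, being future-pointing timelike is an open condition, so such a vector is tangent to a
short causal coordinate segment. Difference quotients of `τ` along it turn (b) into (a), the chart
comparing `d_h` with the Euclidean distance (`exists_forall_future_le`); null vectors are limits of
timelike ones.

Finally, (a) makes `g(∇τ, ·)` positive on the future cone, which forces `∇τ` to be past timelike
(`isPastTimelike_of_forall_pos`). Inserting `-∇τ` into (a) bounds its norm below, and a rescaled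
chart distance serves as `d_U`. -/

namespace NullDistance

open MeasureTheory Filter
open scoped ENNReal NNReal

/-! ### Riemannian distance, growth along curves and charts -/

section RiemannianDistance

/-- The fundamental theorem of calculus, for a function with nonnegative derivative. -/
theorem lintegral_Icc_ofReal_deriv_eq {F F' : ℝ → ℝ} {a b : ℝ} (hab : a ≤ b)
    (hF : ContinuousOn F (Icc a b)) (hF' : ∀ t ∈ Ioo a b, HasDerivAt F (F' t) t)
    (hpos : ∀ t ∈ Ioo a b, 0 ≤ F' t) :
    ∫⁻ t in Icc a b, ENNReal.ofReal (F' t) = ENNReal.ofReal (F b - F a) := by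
  -- No regularity of `F'` is assumed; the sign of the derivative alone yields integrability.
  have hint : IntegrableOn F' (Ioc a b) :=
    intervalIntegral.integrableOn_deriv_of_nonneg hF hF' hpos
  have hint' : IntegrableOn F' (Ioo a b) := hint.mono_set Ioo_subset_Ioc_self
  rw [← intervalIntegral.integral_eq_sub_of_hasDerivAt_of_le hab hF hF'
    ((intervalIntegrable_iff_integrableOn_Ioc_of_le hab).2 hint),
    intervalIntegral.integral_of_le hab, integral_Ioc_eq_integral_Ioo,
    ofReal_integral_eq_lintegral_ofReal hint'
      ((ae_restrict_iff' measurableSet_Ioo).2 (ae_of_all _ hpos)), restrict_Ioo_eq_restrict_Icc]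

variable {E : Type*} [NormedAddCommGroup E] [NormedSpace ℝ E]
  {H : Type*} [TopologicalSpace H] {I : ModelWithCorners ℝ E H}
  {M : Type*} [TopologicalSpace M] [ChartedSpace H M]
  [RiemannianBundle (fun x : M ↦ TangentSpace I x)]

/-- If `f` increases along a curve at rate at least `C` times the speed of the curve, then its
increment is at least `C` times the distance of the endpoints. -/
theorem mul_riemannianEDist_le_of_hasDerivWithinAt {γ : ℝ → M} {a b C : ℝ} (hab : a ≤ b)
    (hC : 0 ≤ C) (hγ : ContMDiffOn 𝓘(ℝ, ℝ) I 1 γ (Icc a b)) {F F' : ℝ → ℝ}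
    (hF : ∀ t ∈ Icc a b, HasDerivWithinAt F (F' t) (Icc a b) t)
    (hF' : ∀ t ∈ Icc a b, C * ‖mfderivWithin 𝓘(ℝ, ℝ) I γ (Icc a b) t (1 : ℝ)‖ ≤ F' t) :
    ENNReal.ofReal C * riemannianEDist I (γ a) (γ b) ≤ ENNReal.ofReal (F b - F a) := by
  rw [← lintegral_Icc_ofReal_deriv_eq hab (fun t ht ↦ (hF t ht).continuousWithinAt)
    (fun t ht ↦ (hF t (Ioo_subset_Icc_self ht)).hasDerivAt (Icc_mem_nhds ht.1 ht.2))
    (fun t ht ↦ (by positivity : (0 : ℝ) ≤ _).trans (hF' t (Ioo_subset_Icc_self ht)))]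
  grw [riemannianEDist_le_pathELength hγ rfl rfl hab]
  rw [pathELength_eq_lintegral_mfderivWithin_Icc, ← lintegral_const_mul' _ _ ENNReal.ofReal_ne_top]
  refine setLIntegral_mono' measurableSet_Icc fun t ht ↦ ?_
  rw [← ofReal_norm, ← ENNReal.ofReal_mul hC]
  exact ENNReal.ofReal_le_ofReal (hF' t ht)

variable [IsManifold I 1 M] [IsContinuousRiemannianBundle E (fun x : M ↦ TangentSpace I x)]

/-- The derivative of the chart is the trivialization of the tangent bundle, whose operator norm is
locally bounded because the metric is continuous. The next lemma is the same for the inverse. -/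
theorem eventually_norm_mfderiv_extChartAt_apply_le (p : M) :
    ∃ K : ℝ≥0, 0 < K ∧ ∀ᶠ y in 𝓝 p, ∀ v : TangentSpace I y,
      ‖(show E from mfderiv I 𝓘(ℝ, E) (extChartAt I p) y v)‖ ≤ K * ‖v‖ := by
  obtain ⟨C, C_pos, hC⟩ := eventually_norm_trivializationAt_lt E (fun x : M ↦ TangentSpace I x) p
  refine ⟨⟨C, C_pos.le⟩, C_pos, ?_⟩
  filter_upwards [hC, chart_source_mem_nhds H p] with y hy h'y v
  rw [← TangentBundle.continuousLinearMapAt_trivializationAt h'y]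
  exact (ContinuousLinearMap.le_of_opNorm_le _ hy.le v)

theorem eventually_norm_le_norm_mfderiv_extChartAt_apply (p : M) :
    ∃ K : ℝ≥0, 0 < K ∧ ∀ᶠ y in 𝓝 p, ∀ v : TangentSpace I y,
      ‖v‖ ≤ K * ‖(show E from mfderiv I 𝓘(ℝ, E) (extChartAt I p) y v)‖ := by
  obtain ⟨C, C_pos, hC⟩ :=
    eventually_norm_symmL_trivializationAt_lt E (fun x : M ↦ TangentSpace I x) p
  refine ⟨⟨C, C_pos.le⟩, C_pos, ?_⟩
  filter_upwards [hC, chart_source_mem_nhds H p] with y hy h'y v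
  rw [← TangentBundle.continuousLinearMapAt_trivializationAt h'y]
  have key := ContinuousLinearMap.le_of_opNorm_le _ hy.le
    ((trivializationAt E (TangentSpace I) p).continuousLinearMapAt ℝ y v)
  rwa [Trivialization.symmL_continuousLinearMapAt _ (by simpa using h'y)] at key

/-- The extended chart is locally Lipschitz for the Riemannian distance. -/
theorem exists_edist_extChartAt_le_mul_riemannianEDist [RegularSpace M] (p : M) :
    ∃ K : ℝ≥0, 0 < K ∧ ∃ U ∈ 𝓝 p, U ⊆ (extChartAt I p).source ∧ ∀ y ∈ U, ∀ z ∈ U,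
      riemannianEDist I y z < ⊤ ∧
      edist (extChartAt I p y) (extChartAt I p z) ≤ K * riemannianEDist I y z := by
  obtain ⟨K, K_pos, hK⟩ := eventually_norm_mfderiv_extChartAt_apply_le (I := I) p
  -- Two points of the `c / 4`-ball are less than `c / 2` apart, so a nearly minimal path between
  -- them stays within `3c / 4` of `p`, where the derivative bound holds.
  obtain ⟨c, c_pos, hc⟩ := setOfPred_riemannianEDist_lt_subset_nhds I
    (inter_mem hK (extChartAt_source_mem_nhds (I := I) p))
  refine ⟨K, K_pos, {y | riemannianEDist I p y < (c / 4 : ℝ≥0)},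
    eventually_riemannianEDist_lt I p (by positivity), fun y hy ↦ ?_, fun y hy z hz ↦ ?_⟩
  · refine (hc ?_).2
    refine lt_of_lt_of_le (show riemannianEDist I p y < (c / 4 : ℝ≥0) from hy) ?_
    exact_mod_cast div_le_self c.2 (by norm_num)
  have hyz : riemannianEDist I y z < (c / 2 : ℝ≥0) := by
    refine (riemannianEDist_triangle (y := p)).trans_lt ?_
    rw [riemannianEDist_comm]
    refine (ENNReal.add_lt_add hy hz).trans_eq ?_
    rw [← ENNReal.coe_add]; congr 1
    ext; push_cast; ring
  refine ⟨hyz.trans ENNReal.coe_lt_top, ?_⟩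
  suffices edist (extChartAt I p y) (extChartAt I p z) / K ≤ riemannianEDist I y z by
    rwa [ENNReal.div_le_iff' (by simpa using K_pos.ne') (by simp)] at this
  refine le_of_forall_gt_imp_ge_of_dense fun r hr ↦ ?_
  rw [ENNReal.div_le_iff' (by simpa using K_pos.ne') (by simp)]
  obtain ⟨γ, rfl, rfl, hγ, hlen⟩ := exists_lt_of_riemannianEDist_lt (lt_min hr hyz)
  have hgood : ∀ t ∈ Icc (0 : ℝ) 1, γ t ∈ {y | ∀ v : TangentSpace I y,
      ‖(show E from mfderiv I 𝓘(ℝ, E) (extChartAt I p) y v)‖ ≤ K * ‖v‖} ∩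
      (extChartAt I p).source := fun t ht ↦ by
    refine hc ?_
    have h1 : riemannianEDist I (γ 0) (γ t) < (c / 2 : ℝ≥0) :=
      (riemannianEDist_le_pathELength (hγ.mono (Icc_subset_Icc_right ht.2)) rfl rfl ht.1).trans_lt
        ((pathELength_mono le_rfl ht.2).trans_lt (hlen.trans_le (min_le_right _ _)))
    refine (riemannianEDist_triangle (y := γ 0)).trans_lt
      ((ENNReal.add_lt_add hy h1).trans_le ?_)
    rw [← ENNReal.coe_add]
    refine ENNReal.coe_le_coe.2 (NNReal.coe_le_coe.1 ?_)
    push_cast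
    linarith [c.coe_nonneg]
  have hγ' : ContMDiffOn 𝓘(ℝ, ℝ) 𝓘(ℝ, E) 1 (extChartAt I p ∘ γ) (Icc 0 1) :=
    contMDiffOn_extChartAt.comp hγ fun t ht ↦ by simpa using (hgood t ht).2
  rw [edist_comm, edist_eq_enorm_sub]
  calc ‖extChartAt I p (γ 1) - extChartAt I p (γ 0)‖ₑ
    _ ≤ ∫⁻ t in Icc 0 1, ‖derivWithin (extChartAt I p ∘ γ) (Icc 0 1) t‖ₑ :=
      enorm_sub_le_lintegral_derivWithin_Icc_of_contDiffOn_Icc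
        (contMDiffOn_iff_contDiffOn.1 hγ') zero_le_one
    _ ≤ ∫⁻ t in Icc 0 1, K * ‖mfderivWithin 𝓘(ℝ, ℝ) I γ (Icc 0 1) t (1 : ℝ)‖ₑ := by
      refine setLIntegral_mono' measurableSet_Icc fun t ht ↦ ?_
      have h1 : mfderivWithin 𝓘(ℝ, ℝ) 𝓘(ℝ, E) (extChartAt I p ∘ γ) (Icc 0 1) t =
          (mfderiv I 𝓘(ℝ, E) (extChartAt I p) (γ t)).comp
            (mfderivWithin 𝓘(ℝ, ℝ) I γ (Icc 0 1) t) :=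
        mfderiv_comp_mfderivWithin t
          (mdifferentiableAt_extChartAt (by simpa using (hgood t ht).2))
          (hγ.mdifferentiableOn one_ne_zero t ht)
          (uniqueMDiffWithinAt_iff_uniqueDiffWithinAt.2 (uniqueDiffOn_Icc zero_lt_one t ht))
      have h2 : derivWithin (extChartAt I p ∘ γ) (Icc 0 1) t =
          (show E from mfderiv I 𝓘(ℝ, E) (extChartAt I p) (γ t)
            (mfderivWithin 𝓘(ℝ, ℝ) I γ (Icc 0 1) t (1 : ℝ))) := by
        rw [← fderivWithin_derivWithin, ← mfderivWithin_eq_fderivWithin]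
        exact congr($h1 (1 : ℝ))
      rw [h2, ← ofReal_norm, ← ofReal_norm, ← ENNReal.ofReal_coe_nnreal,
        ← ENNReal.ofReal_mul K.coe_nonneg]
      exact ENNReal.ofReal_le_ofReal ((hgood t ht).1 _)
    _ = K * pathELength I γ 0 1 := by
      rw [pathELength_eq_lintegral_mfderivWithin_Icc]
      exact lintegral_const_mul' _ _ ENNReal.coe_ne_top
    _ ≤ K * r := by
      gcongr
      exact hlen.le.trans (min_le_left _ _)

end RiemannianDistance

/-! ### Lorentzian linear algebra and local bounds -/

variable {n : ℕ} {M : Type*} [TopologicalSpace M]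
  [ChartedSpace (EuclideanSpace ℝ (Fin (n + 1))) M] [IsManifold (𝓡 (n + 1)) ∞ M]

set_option synthInstance.maxHeartbeats 200000 in
/-- A continuous family of bilinear forms is locally bounded. -/
theorem _root_.ContinuousAt.eventually_norm_bilin_le {X F : Type*} [TopologicalSpace X]
    [NormedAddCommGroup F] [NormedSpace ℝ F] {B : X → F →L[ℝ] F →L[ℝ] ℝ} {p : X}
    (hB : ContinuousAt B p) :
    ∃ K : ℝ, 0 < K ∧ ∀ᶠ q in 𝓝 p, ∀ v w, ‖B q v w‖ ≤ K * ‖v‖ * ‖w‖ := by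
  refine ⟨‖B p‖ + 1, by positivity, ?_⟩
  have h : ContinuousAt (fun q ↦ ‖B q‖) p := ContinuousAt.norm (E := F →L[ℝ] F →L[ℝ] ℝ) hB
  filter_upwards [h.eventually_lt_const (lt_add_one _)] with q hq v w
  exact (B q).le_of_opNorm₂_le_of_le hq.le le_rfl le_rfl

namespace LorentzianMetric

/-- The coordinates of an orthonormal basis identify `g_p` with the Minkowski product. -/
theorem exists_linearEquiv_inner_eq (g : LorentzianMetric n M) (p : M) :
    ∃ L : TangentSpace (𝓡 (n + 1)) p ≃ₗ[ℝ] (Fin (n + 1) → ℝ), ∀ v w,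
      g.inner p v w = -(L v 0 * L w 0) + ∑ i : Fin n, L v i.succ * L w i.succ := by
  obtain ⟨e, he⟩ := g.signature p
  refine ⟨e.equivFun, fun v w ↦ ?_⟩
  conv_lhs => rw [← e.sum_equivFun v, ← e.sum_equivFun w]
  simp only [map_sum, map_smul, sum_apply, smul_apply, he, smul_eq_mul, mul_ite, mul_zero,
    Finset.sum_ite_eq', Finset.mem_univ, if_true]
  rw [Fin.sum_univ_succ]
  simp [Fin.succ_ne_zero, mul_comm]

/-- The scalar product of two continuous vector fields is continuous. -/
theorem continuousAt_inner (g : LorentzianMetric n M) {q : M}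
    {V W : ∀ q : M, TangentSpace (𝓡 (n + 1)) q}
    (hV : ContinuousAt (fun q ↦ (⟨q, V q⟩ : TangentBundle (𝓡 (n + 1)) M)) q)
    (hW : ContinuousAt (fun q ↦ (⟨q, W q⟩ : TangentBundle (𝓡 (n + 1)) M)) q) :
    ContinuousAt (fun q ↦ g.inner q (V q) (W q)) q := by
  have : ContinuousAt (fun q ↦ TotalSpace.mk' ℝ (E := Bundle.Trivial M ℝ) q
      (g.inner q (V q) (W q))) q :=
    g.contMDiff.continuous.continuousAt.clm_bundle_apply₂
      (F₁ := EuclideanSpace ℝ (Fin (n + 1))) (F₂ := EuclideanSpace ℝ (Fin (n + 1))) hV hW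
  rw [FiberBundle.continuousAt_totalSpace] at this
  exact this.2

/-- A Lorentzian metric is locally bounded with respect to a Riemannian one. -/
theorem eventually_abs_inner_self_le (g : LorentzianMetric n M)
    [RiemannianBundle (fun x : M ↦ TangentSpace (𝓡 (n + 1)) x)]
    [IsContinuousRiemannianBundle (EuclideanSpace ℝ (Fin (n + 1)))
      (fun x : M ↦ TangentSpace (𝓡 (n + 1)) x)] (p : M) :
    ∃ K : ℝ, 0 < K ∧ ∀ᶠ q in 𝓝 p, ∀ Z : TangentSpace (𝓡 (n + 1)) q,
      |g.inner q Z Z| ≤ K * ‖Z‖ ^ 2 := by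
  obtain ⟨C, C_pos, hC⟩ := eventually_norm_trivializationAt_lt (EuclideanSpace ℝ (Fin (n + 1)))
    (fun x : M ↦ TangentSpace (𝓡 (n + 1)) x) p
  have hg := g.contMDiff.continuous.continuousAt (x := p)
  rw [FiberBundle.continuousAt_totalSpace] at hg
  set B : M → EuclideanSpace ℝ (Fin (n + 1)) →L[ℝ] EuclideanSpace ℝ (Fin (n + 1)) →L[ℝ] ℝ :=
    fun q ↦ ContinuousLinearMap.inCoordinates (EuclideanSpace ℝ (Fin (n + 1)))
      (fun x : M ↦ TangentSpace (𝓡 (n + 1)) x) (EuclideanSpace ℝ (Fin (n + 1)) →L[ℝ] ℝ)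
      (fun x : M ↦ TangentSpace (𝓡 (n + 1)) x →L[ℝ] Bundle.Trivial M ℝ x) p q p q
      (g.inner q) with hBdef
  have hB : ContinuousAt B p := hg.2
  obtain ⟨K, K_pos, hK⟩ := hB.eventually_norm_bilin_le
  refine ⟨K * C ^ 2, by positivity, ?_⟩
  filter_upwards [hK, hC,
    chart_source_mem_nhds (EuclideanSpace ℝ (Fin (n + 1))) p] with q hq hCq hs Z
  set e := trivializationAt (EuclideanSpace ℝ (Fin (n + 1)))
    (fun x : M ↦ TangentSpace (𝓡 (n + 1)) x) p with he
  have hse : q ∈ e.baseSet := by simpa [he] using hs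
  have key : B q (e.continuousLinearMapAt ℝ q Z) (e.continuousLinearMapAt ℝ q Z) =
      g.inner q Z Z := by
    refine (inCoordinates_apply_eq₂ (𝕜 := ℝ) (F₁ := EuclideanSpace ℝ (Fin (n + 1)))
      (F₂ := EuclideanSpace ℝ (Fin (n + 1))) (F₃ := ℝ) (E₃ := Bundle.Trivial M ℝ)
      hse hse (by simp)).trans ?_
    have h1 : e.symm q (e.continuousLinearMapAt ℝ q Z) = Z :=
      e.symm_linearMapAt hse Z
    rw [h1]
    simp
  have hZ : ‖e.continuousLinearMapAt ℝ q Z‖ ≤ C * ‖Z‖ :=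
    ContinuousLinearMap.le_of_opNorm_le _ hCq.le Z
  rw [← key, ← Real.norm_eq_abs]
  refine (hq _ _).trans ?_
  calc _ ≤ K * (C * ‖Z‖) * (C * ‖Z‖) := by gcongr
    _ = _ := by ring

end LorentzianMetric

namespace Spacetime

/-- A vector whose product with all future-pointing causal vectors is positive is past-pointing
timelike. -/
theorem isPastTimelike_of_forall_pos (g : Spacetime n M) {p : M}
    {Z : TangentSpace (𝓡 (n + 1)) p} (hZ : ∀ X ∈ g.future p, 0 < g.inner p Z X) :
    g.IsPastTimelike p Z := by
  obtain ⟨U, hU, V, -, hV⟩ := g.time_oriented p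
  obtain ⟨hVt, hfut⟩ := hV p (mem_of_mem_nhds hU)
  have hVfut : V p ∈ g.future p := by
    rw [hfut]
    exact ⟨fun h ↦ by simp [h] at hVt, hVt.le, hVt⟩
  suffices hZZ : g.inner p Z Z < 0 by
    refine ⟨hZZ, ?_⟩
    rw [hfut]
    refine ⟨fun h ↦ ?_, by simpa using hZZ.le, ?_⟩
    · simp [neg_eq_zero.1 h] at hZZ
    · simpa [g.symm p (V p) Z] using hZ _ hVfut
  -- If `Z` is not timelike, its spatial part has square norm `S ≥ z₀²`. The null vector with
  -- spatial part opposite to that of `Z` and time part `±√S` then has product at most `|z₀|√S - S ≤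
  -- 0` with `Z`, for either sign.
  by_contra! hZZ
  obtain ⟨L, hL⟩ := g.exists_linearEquiv_inner_eq p
  set z := L Z with hz
  set v := L (V p) with hv
  set S := ∑ i : Fin n, z i.succ * z i.succ with hS
  have hS0 : 0 ≤ S := Finset.sum_nonneg fun i _ ↦ mul_self_nonneg _
  rw [hL] at hZZ hVt
  rw [← hz, ← hS] at hZZ
  rw [← hv] at hVt
  have hZ0 : S ≠ 0 := fun h0 ↦ by
    have h1 : z 0 = 0 := by nlinarith
    have h2 : Z = 0 := by
      refine L.injective ?_
      rw [map_zero]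
      funext i
      refine Fin.cases h1 (fun j ↦ ?_) i
      exact mul_self_eq_zero.1
        ((Finset.sum_eq_zero_iff_of_nonneg fun i _ ↦ mul_self_nonneg _).1 h0 j (Finset.mem_univ _))
    simpa [h2] using hZ _ hVfut
  have hSpos : 0 < S := lt_of_le_of_ne hS0 (Ne.symm hZ0)
  -- The sign `σ` puts the null vector in the same cone as `V p`.
  obtain ⟨σ, hσ, hσv⟩ : ∃ σ : ℝ, σ * σ = 1 ∧ σ * v 0 = |v 0| := by
    rcases le_total 0 (v 0) with h | h
    · exact ⟨1, by simp, by simp [abs_of_nonneg h]⟩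
    · exact ⟨-1, by simp, by simp [abs_of_nonpos h]⟩
  have hsq : √S * √S = S := Real.mul_self_sqrt hS0
  set x : Fin (n + 1) → ℝ := Fin.cons (σ * √S) fun i ↦ -z i.succ with hx
  have hLx : L (L.symm x) = x := L.apply_symm_apply x
  -- Cauchy–Schwarz, strict because `V p` is timelike and `S > 0`.
  have hCS : |∑ i : Fin n, v i.succ * z i.succ| < |v 0| * √S := by
    refine abs_lt_of_sq_lt_sq ?_ (by positivity)
    have h1 := Finset.sum_mul_sq_le_sq_mul_sq Finset.univ (fun i : Fin n ↦ v i.succ)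
      (fun i : Fin n ↦ z i.succ)
    have h2 : ∑ i : Fin n, z i.succ ^ 2 = S := by simp [hS, sq]
    have h3 : ∑ i : Fin n, v i.succ ^ 2 < v 0 ^ 2 := by
      simp only [sq]; linarith
    rw [mul_pow, sq_abs, Real.sq_sqrt hS0]
    rw [h2] at h1
    exact h1.trans_lt (mul_lt_mul_of_pos_right h3 hSpos)
  have hX : L.symm x ∈ g.future p := by
    rw [hfut]
    refine ⟨fun h ↦ ?_, ?_, ?_⟩
    · have h1 := congrFun ((LinearEquiv.symm_apply_eq _).1 h) 0
      simp only [map_zero, hx, Fin.cons_zero, Pi.zero_apply] at h1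
      rcases mul_eq_zero.1 h1 with h1 | h1
      · simp [h1] at hσ
      · exact hZ0 ((Real.sqrt_eq_zero hS0).1 h1)
    · rw [hL, hLx]
      simp only [hx, Fin.cons_zero, Fin.cons_succ, neg_mul_neg]
      rw [← hS]
      nlinarith
    · rw [hL, hLx, ← hv]
      simp only [hx, Fin.cons_zero, Fin.cons_succ, mul_neg, Finset.sum_neg_distrib]
      have h1 : v 0 * (σ * √S) = |v 0| * √S := by rw [← hσv]; ring
      rw [h1]
      linarith [neg_abs_le (∑ i : Fin n, v i.succ * z i.succ)]
  have hpos := hZ _ hX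
  rw [hL, hLx, ← hz] at hpos
  simp only [hx, Fin.cons_zero, Fin.cons_succ, mul_neg, Finset.sum_neg_distrib] at hpos
  rw [← hS] at hpos
  have h1 : |z 0 * σ| ≤ √S := by
    refine Real.abs_le_sqrt ?_
    nlinarith
  nlinarith [neg_abs_le (z 0 * σ), Real.sqrt_nonneg S]

/-! ### Monotonicity of `τ` along causal curves -/

theorem IsSmoothFutureCausal.mono {g : Spacetime n M} {α : ℝ → M} {a b c d : ℝ}
    (h : g.IsSmoothFutureCausal α a b) (hac : a ≤ c) (hcd : c < d) (hdb : d ≤ b) :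
    g.IsSmoothFutureCausal α c d := by
  have hsub : Icc c d ⊆ Icc a b := Icc_subset_Icc hac hdb
  refine ⟨hcd, h.2.1.mono hsub, fun t ht ↦ ?_⟩
  rw [mfderivWithin_subset hsub
    (uniqueMDiffWithinAt_iff_uniqueDiffWithinAt.2 (uniqueDiffOn_Icc hcd t ht))
    (h.2.1.mdifferentiableOn (by simp) t (hsub ht))]
  exact h.2.2 t (hsub ht)

/-- The chain rule along a curve, in terms of the gradient. -/
theorem hasDerivWithinAt_comp (g : Spacetime n M) {τ : M → ℝ}
    (hτ : MDifferentiable (𝓡 (n + 1)) 𝓘(ℝ, ℝ) τ) {α : ℝ → M} {s : Set ℝ} {t : ℝ}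
    (hα : MDifferentiableWithinAt 𝓘(ℝ, ℝ) (𝓡 (n + 1)) α s t) :
    HasDerivWithinAt (τ ∘ α) (g.inner (α t) (g.gradient τ (α t))
      (mfderivWithin 𝓘(ℝ, ℝ) (𝓡 (n + 1)) α s t (1 : ℝ))) s t := by
  rw [g.inner_gradient]
  have h := (hτ (α t)).hasMFDerivAt.comp_hasMFDerivWithinAt t hα.hasMFDerivWithinAt
  have h' : HasFDerivWithinAt (τ ∘ α) (show ℝ →L[ℝ] ℝ from
      (mfderiv (𝓡 (n + 1)) 𝓘(ℝ, ℝ) τ (α t)).comp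
        (mfderivWithin 𝓘(ℝ, ℝ) (𝓡 (n + 1)) α s t)) s t :=
    HasMFDerivWithinAt.hasFDerivWithinAt h
  exact h'.hasDerivWithinAt

theorem IsSmoothFutureCausal.hasDerivWithinAt {g : Spacetime n M} {τ : M → ℝ}
    (hτ : MDifferentiable (𝓡 (n + 1)) 𝓘(ℝ, ℝ) τ) {α : ℝ → M} {a b : ℝ}
    (h : g.IsSmoothFutureCausal α a b) {t : ℝ} (ht : t ∈ Icc a b) :
    HasDerivWithinAt (τ ∘ α) (g.inner (α t) (g.gradient τ (α t))
      (mfderivWithin 𝓘(ℝ, ℝ) (𝓡 (n + 1)) α (Icc a b) t (1 : ℝ))) (Icc a b) t :=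
  g.hasDerivWithinAt_comp hτ (h.2.1.mdifferentiableOn (by simp) t ht)

theorem IsSmoothFutureCausal.strictMonoOn {g : Spacetime n M} {τ : M → ℝ}
    (hτ : MDifferentiable (𝓡 (n + 1)) 𝓘(ℝ, ℝ) τ)
    (hpos : ∀ q, ∀ X ∈ g.future q, 0 < g.inner q (g.gradient τ q) X) {α : ℝ → M} {a b : ℝ}
    (h : g.IsSmoothFutureCausal α a b) : StrictMonoOn (τ ∘ α) (Icc a b) := by
  refine strictMonoOn_of_hasDerivWithinAt_pos (convex_Icc a b)
    (fun t ht ↦ (h.hasDerivWithinAt hτ ht).continuousWithinAt)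
    (fun t ht ↦ (h.hasDerivWithinAt hτ (interior_subset ht)).mono interior_subset)
    fun t ht ↦ hpos _ _ (h.2.2 t (interior_subset ht))

theorem isGeneralizedTimeFunction_of_forall_pos {g : Spacetime n M} {τ : M → ℝ}
    (hτ : MDifferentiable (𝓡 (n + 1)) 𝓘(ℝ, ℝ) τ)
    (hpos : ∀ q, ∀ X ∈ g.future q, 0 < g.inner q (g.gradient τ q) X) :
    g.IsGeneralizedTimeFunction τ := by
  rintro α a b ⟨k, s, hk, rfl, rfl, hs⟩
  have key : ∀ i ≤ k, s 0 ≤ s i ∧ StrictMonoOn (τ ∘ α) (Icc (s 0) (s i)) := by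
    intro i hi
    induction i with
    | zero => simp
    | succ i ih =>
      obtain ⟨h1, h2⟩ := ih (by omega)
      have h3 := hs i (by omega)
      refine ⟨h1.trans h3.1.le, ?_⟩
      rw [← Icc_union_Icc_eq_Icc h1 h3.1.le]
      exact h2.union (h3.strictMonoOn hτ hpos) (isGreatest_Icc h1) (isLeast_Icc h3.1.le)
  exact (key k le_rfl).2

theorem partition_le {g : Spacetime n M} {α : ℝ → M} {k : ℕ} {s : ℕ → ℝ}
    (hs : ∀ i < k, g.IsSmoothFutureCausal α (s i) (s (i + 1))) {i j : ℕ} (hij : i ≤ j)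
    (hj : j ≤ k) : s i ≤ s j := by
  induction j, hij using Nat.le_induction with
  | base => rfl
  | succ j _ ih => exact (ih (by omega)).trans (hs j (by omega)).1.le

theorem IsFutureCausalCurve.le {g : Spacetime n M} {α : ℝ → M} {a b : ℝ}
    (h : g.IsFutureCausalCurve α a b) : a ≤ b := by
  obtain ⟨k, s, -, rfl, rfl, hs⟩ := h
  exact partition_le hs k.zero_le le_rfl

/-! ### From the gradient bound to the distance bound -/

section Riemannian

variable [RiemannianBundle (fun x : M ↦ TangentSpace (𝓡 (n + 1)) x)]
  [IsContinuousRiemannianBundle (EuclideanSpace ℝ (Fin (n + 1)))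
    (fun x : M ↦ TangentSpace (𝓡 (n + 1)) x)] [RegularSpace M]

theorem continuous_riemannianEDist (x : M) :
    Continuous fun y ↦ riemannianEDist (𝓡 (n + 1)) x y := by
  let : PseudoEMetricSpace M := PseudoEMetricSpace.ofRiemannianMetric (𝓡 (n + 1)) M
  exact (continuous_const.edist continuous_id : Continuous fun y : M ↦ edist x y)

/-- Along a causal curve which starts at `c`, the anti-Lipschitz estimate with respect to a point
`x` is propagated as long as `τ` has not increased so much that the curve may have left the
`ρ`-ball around `x`. -/
theorem IsSmoothFutureCausal.mul_riemannianEDist_le {g : Spacetime n M} {τ : M → ℝ}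
    (hτ : MDifferentiable (𝓡 (n + 1)) 𝓘(ℝ, ℝ) τ)
    (hpos : ∀ q, ∀ X ∈ g.future q, 0 < g.inner q (g.gradient τ q) X)
    {x : M} {C ρ : ℝ} (hC : 0 < C)
    (hball : ∀ q, riemannianEDist (𝓡 (n + 1)) x q < ENNReal.ofReal ρ →
      ∀ X ∈ g.future q, C * ‖X‖ ≤ g.inner q (g.gradient τ q) X)
    {α : ℝ → M} {c d : ℝ} (h : g.IsSmoothFutureCausal α c d)
    (hxc : τ x ≤ τ (α c)) (hlt : τ (α d) - τ x < C * ρ)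
    (hc : ENNReal.ofReal C * riemannianEDist (𝓡 (n + 1)) x (α c) ≤
      ENNReal.ofReal (τ (α c) - τ x)) :
    ENNReal.ofReal C * riemannianEDist (𝓡 (n + 1)) x (α d) ≤
      ENNReal.ofReal (τ (α d) - τ x) := by
  have hmono := (h.strictMonoOn hτ hpos).monotoneOn
  have hα : ContinuousOn α (Icc c d) := h.2.1.continuousOn
  have hdist : ContinuousOn (fun t ↦ riemannianEDist (𝓡 (n + 1)) x (α t)) (Icc c d) :=
    (continuous_riemannianEDist x).comp_continuousOn hα
  -- Continuous induction: the times at which the estimate holds form a closed set, which is shown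
  -- to extend to the right of each of its points.
  have hclosed : IsClosed ({t | ENNReal.ofReal C * riemannianEDist (𝓡 (n + 1)) x (α t) ≤
      ENNReal.ofReal (τ (α t) - τ x)} ∩ Icc c d) := by
    rw [inter_comm]
    refine isClosed_Icc.isClosed_le
      ((ENNReal.continuous_const_mul ENNReal.ofReal_ne_top).comp_continuousOn hdist)
      (ENNReal.continuous_ofReal.comp_continuousOn ?_)
    exact (hτ.continuous.comp_continuousOn hα).sub continuousOn_const
  refine hclosed.Icc_subset_of_forall_mem_nhdsWithin hc ?_ (right_mem_Icc.2 h.1.le)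
  rintro t ⟨ht, htc, htd⟩
  have htI : t ∈ Icc c d := ⟨htc, htd.le⟩
  have hxt : τ x ≤ τ (α t) := hxc.trans (hmono (left_mem_Icc.2 h.1.le) htI htc)
  -- The estimate at time `t` itself confines the curve: `C * d(x, α t) ≤ τ (α t) - τ x ≤ τ (α d) -
  -- τ x < C * ρ`.
  have hρ : riemannianEDist (𝓡 (n + 1)) x (α t) < ENNReal.ofReal ρ := by
    have h1 : ENNReal.ofReal C * riemannianEDist (𝓡 (n + 1)) x (α t) <
        ENNReal.ofReal C * ENNReal.ofReal ρ := by
      rw [← ENNReal.ofReal_mul hC.le]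
      have h2 : τ (α t) ≤ τ (α d) := hmono htI (right_mem_Icc.2 h.1.le) htd.le
      refine lt_of_le_of_lt ht ((ENNReal.ofReal_lt_ofReal_iff_of_nonneg ?_).2 ?_) <;> linarith
    exact lt_of_mul_lt_mul_left' h1
  have hnear : ∀ᶠ s in 𝓝[≥] t, riemannianEDist (𝓡 (n + 1)) x (α s) < ENNReal.ofReal ρ :=
    ((hdist t htI).mono_of_mem_nhdsWithin (Icc_mem_nhdsGE_of_mem ⟨htc, htd⟩)).eventually_lt_const hρ
  obtain ⟨u, htu, hu⟩ := (mem_nhdsGE_iff_exists_Ico_subset' htd).1 hnear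
  filter_upwards [Ioo_mem_nhdsGT htu, Ioo_mem_nhdsGT htd] with s hsu hsd
  have hsub := h.mono htc hsu.1 hsd.2.le
  have hstep := mul_riemannianEDist_le_of_hasDerivWithinAt hsu.1.le hC.le
    (hsub.2.1.of_le (by simp)) (fun r hr ↦ hsub.hasDerivWithinAt hτ hr)
    fun r hr ↦ hball _ (hu ⟨hr.1, hr.2.trans_lt hsu.2⟩) _ (hsub.2.2 r hr)
  have hts : τ (α t) ≤ τ (α s) :=
    hmono htI ⟨htc.trans hsu.1.le, hsd.2.le⟩ hsu.1.le
  calc ENNReal.ofReal C * riemannianEDist (𝓡 (n + 1)) x (α s)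
    _ ≤ ENNReal.ofReal C * (riemannianEDist (𝓡 (n + 1)) x (α t) +
        riemannianEDist (𝓡 (n + 1)) (α t) (α s)) := by
      gcongr
      exact riemannianEDist_triangle
    _ ≤ ENNReal.ofReal (τ (α t) - τ x) + ENNReal.ofReal (τ (α s) - τ (α t)) := by
      rw [mul_add]
      exact add_le_add ht hstep
    _ = ENNReal.ofReal (τ (α s) - τ x) := by
      rw [← ENNReal.ofReal_add (by linarith) (by linarith)]
      congr 1
      ring

theorem IsFutureCausalCurve.mul_riemannianEDist_le {g : Spacetime n M} {τ : M → ℝ}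
    (hτ : MDifferentiable (𝓡 (n + 1)) 𝓘(ℝ, ℝ) τ)
    (hpos : ∀ q, ∀ X ∈ g.future q, 0 < g.inner q (g.gradient τ q) X)
    {α : ℝ → M} {a b C ρ : ℝ} (hC : 0 < C)
    (hball : ∀ q, riemannianEDist (𝓡 (n + 1)) (α a) q < ENNReal.ofReal ρ →
      ∀ X ∈ g.future q, C * ‖X‖ ≤ g.inner q (g.gradient τ q) X)
    (h : g.IsFutureCausalCurve α a b) (hlt : τ (α b) - τ (α a) < C * ρ) :
    ENNReal.ofReal C * riemannianEDist (𝓡 (n + 1)) (α a) (α b) ≤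
      ENNReal.ofReal (τ (α b) - τ (α a)) := by
  have hmono := (isGeneralizedTimeFunction_of_forall_pos hτ hpos α a b h).monotoneOn
  obtain ⟨k, s, -, rfl, rfl, hs⟩ := h
  have hle : ∀ i ≤ k, s 0 ≤ s i := fun i hi ↦ partition_le hs i.zero_le hi
  have hle' : ∀ i ≤ k, s i ≤ s k := fun i hi ↦ partition_le hs hi le_rfl
  have key : ∀ i ≤ k, ENNReal.ofReal C * riemannianEDist (𝓡 (n + 1)) (α (s 0)) (α (s i)) ≤
      ENNReal.ofReal (τ (α (s i)) - τ (α (s 0))) := fun i hi ↦ by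
    induction i with
    | zero => simp [riemannianEDist_self]
    | succ i ih =>
      refine (hs i (by omega)).mul_riemannianEDist_le hτ hpos hC hball ?_ ?_ (ih (by omega))
      · exact hmono ⟨le_rfl, hle k le_rfl⟩ ⟨hle i (by omega), hle' i (by omega)⟩ (hle i (by omega))
      · refine lt_of_le_of_lt (sub_le_sub_right ?_ _) hlt
        exact hmono ⟨hle _ hi, hle' _ hi⟩ ⟨hle k le_rfl, le_rfl⟩ (hle' _ hi)
  exact key k le_rfl

theorem exists_forall_causallyPrecedes_le {g : Spacetime n M} {τ : M → ℝ}
    (hτ : MDifferentiable (𝓡 (n + 1)) 𝓘(ℝ, ℝ) τ)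
    (hpos : ∀ q, ∀ X ∈ g.future q, 0 < g.inner q (g.gradient τ q) X) {p : M}
    {U : Set M} (hU : U ∈ 𝓝 p) {C : ℝ} (hC : 0 < C)
    (h : ∀ q ∈ U, ∀ X ∈ g.future q, C * ‖X‖ ≤ g.inner q (g.gradient τ q) X) :
    ∃ W ∈ 𝓝 p, ∀ x ∈ W, ∀ y ∈ W, g.CausallyPrecedes x y →
      C * (riemannianEDist (𝓡 (n + 1)) x y).toReal ≤ τ y - τ x := by
  obtain ⟨c, c_pos, hc⟩ := setOfPred_riemannianEDist_lt_subset_nhds (𝓡 (n + 1)) hU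
  refine ⟨{y | riemannianEDist (𝓡 (n + 1)) p y < (c / 4 : ℝ≥0)},
    eventually_riemannianEDist_lt (𝓡 (n + 1)) p (by positivity), fun x hx y hy hxy ↦ ?_⟩
  rcases hxy with rfl | ⟨α, a, b, hα, rfl, rfl⟩
  · simp [riemannianEDist_self]
  have hdist : riemannianEDist (𝓡 (n + 1)) (α a) (α b) < ENNReal.ofReal (c / 2 : ℝ≥0) := by
    rw [ENNReal.ofReal_coe_nnreal]
    refine (riemannianEDist_triangle (y := p)).trans_lt ?_
    rw [riemannianEDist_comm]
    refine (ENNReal.add_lt_add hx hy).trans_eq ?_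
    rw [← ENNReal.coe_add]; congr 1
    ext; push_cast; ring
  have hinc : τ (α a) ≤ τ (α b) :=
    (isGeneralizedTimeFunction_of_forall_pos hτ hpos α a b hα).monotoneOn
      (left_mem_Icc.2 hα.le) (right_mem_Icc.2 hα.le) hα.le
  -- A small gain confines the curve to the `c / 2`-ball around `α a`, hence to the `c`-ball around
  -- `p`, inside `U`. A large gain suffices by itself, as the endpoints are less than `c / 2` apart.
  rcases lt_or_ge (τ (α b) - τ (α a)) (C * (c / 2 : ℝ≥0)) with hlt | hge
  · have key := hα.mul_riemannianEDist_le hτ hpos hC (fun q hq ↦ h q (hc ?_)) hlt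
    · have := ENNReal.toReal_mono ENNReal.ofReal_ne_top key
      rwa [ENNReal.toReal_mul, ENNReal.toReal_ofReal hC.le,
        ENNReal.toReal_ofReal (by linarith)] at this
    · rw [ENNReal.ofReal_coe_nnreal] at hq
      refine (riemannianEDist_triangle (y := α a)).trans_lt
        ((ENNReal.add_lt_add hx hq).trans_le ?_)
      rw [← ENNReal.coe_add]
      refine ENNReal.coe_le_coe.2 (NNReal.coe_le_coe.1 ?_)
      push_cast
      linarith [c.coe_nonneg]
  · refine le_trans ?_ hge
    gcongr
    exact ENNReal.toReal_le_of_le_ofReal (NNReal.coe_nonneg _) hdist.le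

end Riemannian

/-! ### Causal segments and the return to the gradient bound -/

/-- A future-pointing timelike vector at `q` is tangent to a future causal curve which is a
segment in a given chart around `q`. -/
theorem exists_isSmoothFutureCausal_segment (g : Spacetime n M) {p q : M}
    (hq : q ∈ (extChartAt (𝓡 (n + 1)) p).source) {X : TangentSpace (𝓡 (n + 1)) q}
    (hX : X ∈ g.future q) (hXt : g.inner q X X < 0) :
    ∃ α : ℝ → M, ∃ ε > 0, g.IsSmoothFutureCausal α 0 ε ∧ α 0 = q ∧
      (show EuclideanSpace ℝ (Fin (n + 1)) from
        mfderivWithin 𝓘(ℝ, ℝ) (𝓡 (n + 1)) α (Icc 0 ε) 0 (1 : ℝ)) = X ∧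
      ∀ t ∈ Icc 0 ε, extChartAt (𝓡 (n + 1)) p (α t) = extChartAt (𝓡 (n + 1)) p q +
        t • (show EuclideanSpace ℝ (Fin (n + 1)) from
          mfderiv (𝓡 (n + 1)) 𝓘(ℝ, EuclideanSpace ℝ (Fin (n + 1)))
            (extChartAt (𝓡 (n + 1)) p) q X) := by
  set φ := extChartAt (𝓡 (n + 1)) p with hφ
  have hqc : q ∈ (chartAt (EuclideanSpace ℝ (Fin (n + 1))) p).source := by simpa [hφ] using hq
  set e := trivializationAt (EuclideanSpace ℝ (Fin (n + 1)))
    (TangentSpace (𝓡 (n + 1)) : M → Type _) p with he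
  have hqe : q ∈ e.baseSet := by simpa [he] using hqc
  set w : EuclideanSpace ℝ (Fin (n + 1)) :=
    mfderiv (𝓡 (n + 1)) 𝓘(ℝ, EuclideanSpace ℝ (Fin (n + 1))) φ q X with hw
  have hwe : w = e.continuousLinearMapAt ℝ q X := by
    rw [hw, ← TangentBundle.continuousLinearMapAt_trivializationAt hqc]
    rfl
  -- The field with constant coordinates `w` is the velocity of the coordinate segment, so causality
  -- of the segment reduces to that of `W` near `q`.
  set W : ∀ y : M, TangentSpace (𝓡 (n + 1)) y := fun y ↦ e.symm y w with hW
  have hWq : W q = X := by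
    rw [hW, hwe]
    exact e.symm_linearMapAt (R := ℝ) hqe X
  have hWcont : ContinuousAt (fun y ↦ (⟨y, W y⟩ : TangentBundle (𝓡 (n + 1)) M)) q := by
    have h1 := e.continuousOn_symm.continuousAt (x := (q, w))
      ((e.open_baseSet.prod isOpen_univ).mem_nhds ⟨hqe, trivial⟩)
    exact ContinuousAt.comp (f := fun y ↦ (y, w)) h1 (by fun_prop)
  -- near `q`, the vector field `W` is future-pointing timelike
  have hfut : ∀ᶠ y in 𝓝 q, W y ∈ g.future y := by
    obtain ⟨U, hU, V, hVc, hV⟩ := g.time_oriented q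
    have h1 := (g.continuousAt_inner hWcont hWcont).eventually_lt_const (hWq ▸ hXt)
    have h2 := (g.continuousAt_inner (hVc.continuousAt hU) hWcont).eventually_lt_const
      (u := 0) (by
        rw [(hV q (mem_of_mem_nhds hU)).2] at hX
        change g.inner q (V q) (W q) < 0
        rw [hWq]
        exact hX.2.2)
    filter_upwards [h1, h2, hU] with y hy1 hy2 hyU
    rw [(hV y hyU).2]
    exact ⟨fun h ↦ by simp [h] at hy1, hy1.le, hy2⟩
  set η : ℝ → EuclideanSpace ℝ (Fin (n + 1)) := fun t ↦ φ q + t • w with hη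
  have hη0 : η 0 = φ q := by simp [hη]
  have hηc : Continuous η := by fun_prop
  have hηd : ∀ t, HasDerivAt η w t := fun t ↦ by
    simpa only [id, one_smul] using ((hasDerivAt_id t).smul_const w).const_add (φ q)
  set α : ℝ → M := φ.symm ∘ η with hα
  have hα0 : α 0 = q := by simp [hα, hη0, φ.left_inv hq]
  have htarget : ∀ᶠ t in 𝓝 (0 : ℝ), η t ∈ φ.target :=
    hηc.continuousAt.eventually_mem (by
      rw [hη0]
      exact (isOpen_extChartAt_target p).mem_nhds (φ.map_source hq))
  have hαc : ContinuousAt α 0 := by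
    refine ContinuousAt.comp ?_ hηc.continuousAt
    rw [hη0]
    exact continuousAt_extChartAt_symm' hq
  have hev : ∀ᶠ t in 𝓝 (0 : ℝ), η t ∈ φ.target ∧ W (α t) ∈ g.future (α t) :=
    htarget.and (hαc.eventually (hα0 ▸ hfut))
  obtain ⟨ε, hε, hball⟩ := Metric.eventually_nhds_iff.1 hev
  have hgood : ∀ t ∈ Icc 0 (ε / 2), η t ∈ φ.target ∧ W (α t) ∈ g.future (α t) := fun t ht ↦
    hball (by rw [Real.dist_eq, sub_zero, abs_of_nonneg ht.1]; linarith [ht.2])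
  have hder : ∀ t ∈ Icc 0 (ε / 2),
      (show EuclideanSpace ℝ (Fin (n + 1)) from
        mfderivWithin 𝓘(ℝ, ℝ) (𝓡 (n + 1)) α (Icc 0 (ε / 2)) t (1 : ℝ)) = W (α t) := by
    intro t ht
    have h1 : mfderivWithin 𝓘(ℝ, ℝ) (𝓡 (n + 1)) α (Icc 0 (ε / 2)) t =
        (mfderivWithin 𝓘(ℝ, EuclideanSpace ℝ (Fin (n + 1))) (𝓡 (n + 1)) φ.symm
          (range (𝓡 (n + 1))) (η t)).comp
          (mfderivWithin 𝓘(ℝ, ℝ) 𝓘(ℝ, EuclideanSpace ℝ (Fin (n + 1))) η (Icc 0 (ε / 2)) t) := by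
      refine mfderivWithin_comp t (mdifferentiableWithinAt_extChartAt_symm (hgood t ht).1)
        ((hηd t).differentiableAt.mdifferentiableAt.mdifferentiableWithinAt)
        (fun s _ ↦ by simp)
        (uniqueMDiffWithinAt_iff_uniqueDiffWithinAt.2
          (uniqueDiffOn_Icc (by positivity) t ht))
    have h2 : (show EuclideanSpace ℝ (Fin (n + 1)) from
        mfderivWithin 𝓘(ℝ, ℝ) 𝓘(ℝ, EuclideanSpace ℝ (Fin (n + 1))) η
          (Icc 0 (ε / 2)) t (1 : ℝ)) = w := by
      rw [mfderivWithin_eq_fderivWithin]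
      exact (fderivWithin_derivWithin (𝕜 := ℝ) (f := η) (s := Icc 0 (ε / 2)) (x := t)).trans
        ((hηd t).hasDerivWithinAt.derivWithin (uniqueDiffOn_Icc (by positivity) t ht))
    have h3 : α t ∈ (chartAt (EuclideanSpace ℝ (Fin (n + 1))) p).source := by
      rw [← extChartAt_source (𝓡 (n + 1))]
      exact φ.map_target (hgood t ht).1
    have h4 := TangentBundle.symmL_trivializationAt (I := 𝓡 (n + 1)) (𝕜 := ℝ) h3
    have h5 : extChartAt (𝓡 (n + 1)) p (α t) = η t := φ.right_inv (hgood t ht).1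
    rw [h5] at h4
    refine (congr($h1 (1 : ℝ))).trans ?_
    refine (congrArg (mfderivWithin 𝓘(ℝ, EuclideanSpace ℝ (Fin (n + 1))) (𝓡 (n + 1)) φ.symm
      (range (𝓡 (n + 1))) (η t)) h2).trans ?_
    exact (congr($h4 w)).symm.trans (e.symmL_apply (R := ℝ) (by simpa [he] using h3) w)
  refine ⟨α, ε / 2, by positivity, ⟨by positivity, ?_, fun t ht ↦ ?_⟩, hα0, ?_, fun t ht ↦ ?_⟩
  · exact (contMDiffOn_extChartAt_symm p).comp
      ((contMDiff_iff_contDiff.2 (by fun_prop)).contMDiffOn) fun t ht ↦ (hgood t ht).1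
  · have := (hgood t ht).2
    rw [← hder t ht] at this
    exact this
  · rw [hder 0 ⟨le_rfl, by positivity⟩, hα0, hWq]
  · exact φ.right_inv (hgood t ht).1

theorem ne_zero_of_mem_future (g : Spacetime n M) {q : M} {X : TangentSpace (𝓡 (n + 1)) q}
    (hX : X ∈ g.future q) : X ≠ 0 := by
  obtain ⟨U, hU, V, -, hV⟩ := g.time_oriented q
  rw [(hV q (mem_of_mem_nhds hU)).2] at hX
  exact hX.1

/-- Each future-pointing causal vector is a limit of timelike ones. -/
theorem exists_forall_add_smul_mem_future (g : Spacetime n M) {q : M}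
    {X : TangentSpace (𝓡 (n + 1)) q} (hX : X ∈ g.future q) :
    ∃ V : TangentSpace (𝓡 (n + 1)) q, ∀ ε : ℝ, 0 < ε →
      X + ε • V ∈ g.future q ∧ g.inner q (X + ε • V) (X + ε • V) < 0 := by
  obtain ⟨U, hU, V, -, hV⟩ := g.time_oriented q
  obtain ⟨hVt, hfut⟩ := hV q (mem_of_mem_nhds hU)
  rw [hfut] at hX ⊢
  refine ⟨V q, fun ε hε ↦ ?_⟩
  have h1 : g.inner q (X + ε • V q) (X + ε • V q) < 0 := by
    have : g.inner q (X + ε • V q) (X + ε • V q) = g.inner q X X +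
        2 * (ε * g.inner q (V q) X) + ε ^ 2 * g.inner q (V q) (V q) := by
      simp only [map_add, map_smul, add_apply, smul_apply, smul_eq_mul, g.symm q X (V q)]
      ring
    rw [this]
    have h2 := mul_neg_of_pos_of_neg hε hX.2.2
    have h3 := mul_neg_of_pos_of_neg (pow_pos hε 2) hVt
    linarith [hX.2.1]
  refine ⟨⟨fun h ↦ by simp [h] at h1, h1.le, ?_⟩, h1⟩
  simp only [map_add, map_smul, smul_eq_mul]
  linarith [mul_neg_of_pos_of_neg hε hVt, hX.2.2]

section Riemannian

variable [RiemannianBundle (fun x : M ↦ TangentSpace (𝓡 (n + 1)) x)]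

/-- A lower bound on the gradient extends from timelike to causal vectors. -/
theorem forall_future_of_forall_timelike (g : Spacetime n M) {q : M}
    {Z : TangentSpace (𝓡 (n + 1)) q} {C : ℝ}
    (h : ∀ X ∈ g.future q, g.inner q X X < 0 → C * ‖X‖ ≤ g.inner q Z X)
    {X : TangentSpace (𝓡 (n + 1)) q} (hX : X ∈ g.future q) : C * ‖X‖ ≤ g.inner q Z X := by
  obtain ⟨V, hV⟩ := g.exists_forall_add_smul_mem_future hX
  have h1 : Tendsto (fun ε : ℝ ↦ C * ‖X + ε • V‖) (𝓝[>] 0) (𝓝 (C * ‖X + (0 : ℝ) • V‖)) :=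
    (Continuous.tendsto (by fun_prop) 0).mono_left nhdsWithin_le_nhds
  have h2 : Tendsto (fun ε : ℝ ↦ g.inner q Z X + ε * g.inner q Z V) (𝓝[>] 0)
      (𝓝 (g.inner q Z X + 0 * g.inner q Z V)) :=
    (Continuous.tendsto (by fun_prop) 0).mono_left nhdsWithin_le_nhds
  rw [zero_smul, add_zero] at h1
  rw [zero_mul, add_zero] at h2
  refine le_of_tendsto_of_tendsto h1 h2 ?_
  filter_upwards [self_mem_nhdsWithin] with ε hε
  simpa using h _ (hV ε hε).1 (hV ε hε).2

variable [IsContinuousRiemannianBundle (EuclideanSpace ℝ (Fin (n + 1)))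
    (fun x : M ↦ TangentSpace (𝓡 (n + 1)) x)]

/-- With `Z = ∇τ`, the hypothesis at `X = -Z` reads `C‖Z‖ ≤ |g(Z, Z)|`, while `|g(Z, Z)| ≤ K‖Z‖²` by
local boundedness of `g`. Eliminating `‖Z‖` gives `|g(Z, Z)| ≥ C² / K`. -/
theorem exists_forall_le_gnorm_gradient {g : Spacetime n M} {τ : M → ℝ} {p : M}
    (hpast : ∀ q, g.IsPastTimelike q (g.gradient τ q))
    {U : Set M} (hU : U ∈ 𝓝 p) {C : ℝ} (hC : 0 < C)
    (h : ∀ q ∈ U, ∀ X ∈ g.future q, C * ‖X‖ ≤ g.inner q (g.gradient τ q) X) :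
    ∃ W ∈ 𝓝 p, ∃ C' : ℝ, 0 < C' ∧ ∀ q ∈ W, C' ≤ g.gnorm q (g.gradient τ q) := by
  obtain ⟨K, K_pos, hK⟩ := g.eventually_abs_inner_self_le p
  refine ⟨_, inter_mem hU hK, C / √K, by positivity, fun q ⟨hqU, hqK⟩ ↦ Real.le_sqrt_of_sq_le ?_⟩
  obtain ⟨hneg, hfut⟩ := hpast q
  have h1 := h q hqU _ hfut
  have h2 := hqK (g.gradient τ q)
  rw [norm_neg, map_neg, ← abs_of_neg hneg] at h1
  have h3 : 0 < |g.inner q (g.gradient τ q) (g.gradient τ q)| := abs_pos.2 hneg.ne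
  rw [div_pow, Real.sq_sqrt K_pos.le, div_le_iff₀ K_pos]
  refine le_of_mul_le_mul_right ?_ h3
  have h4 := mul_self_le_mul_self (by positivity) h1
  nlinarith [mul_le_mul_of_nonneg_left h2 (sq_nonneg C), mul_le_mul_of_nonneg_left h4 K_pos.le]

variable [RegularSpace M]

theorem exists_forall_future_le {g : Spacetime n M} {τ : M → ℝ}
    (hτ : MDifferentiable (𝓡 (n + 1)) 𝓘(ℝ, ℝ) τ) {p : M} {U : Set M} (hU : U ∈ 𝓝 p) {C : ℝ}
    (hC : 0 < C) (h : ∀ x ∈ U, ∀ y ∈ U, g.CausallyPrecedes x y →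
      C * (riemannianEDist (𝓡 (n + 1)) x y).toReal ≤ τ y - τ x) :
    ∃ W ∈ 𝓝 p, ∃ C' : ℝ, 0 < C' ∧
      ∀ q ∈ W, ∀ X ∈ g.future q, C' * ‖X‖ ≤ g.inner q (g.gradient τ q) X := by
  obtain ⟨K, K_pos, U', hU', hsource, hK⟩ :=
    exists_edist_extChartAt_le_mul_riemannianEDist (I := 𝓡 (n + 1)) p
  obtain ⟨L, L_pos, hL⟩ := eventually_norm_le_norm_mfderiv_extChartAt_apply (I := 𝓡 (n + 1)) p
  -- `U ∩ U'` must be a neighborhood of `q`, so that a curve from `q` stays in it briefly. `K` is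
  -- the Lipschitz constant of the chart, and `L` bounds `‖X‖` by the coordinate norm.
  refine ⟨_, (eventually_mem_nhds_iff.2 (inter_mem hU hU')).and hL, C / (K * L),
    by positivity, fun q ⟨hqU, hqL⟩ X hX ↦ g.forall_future_of_forall_timelike ?_ hX⟩
  clear X hX
  intro X hX hXt
  obtain ⟨α, ε, hε, hα, rfl, hder, hseg⟩ := g.exists_isSmoothFutureCausal_segment
    (hsource (mem_of_mem_nhds hqU).2) hX hXt
  set w : EuclideanSpace ℝ (Fin (n + 1)) := mfderiv (𝓡 (n + 1))
    𝓘(ℝ, EuclideanSpace ℝ (Fin (n + 1))) (extChartAt (𝓡 (n + 1)) p) (α 0) X with hw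
  have h0 : (0 : ℝ) ∈ Icc 0 ε := left_mem_Icc.2 hε.le
  have hd : HasDerivWithinAt (τ ∘ α) (g.inner (α 0) (g.gradient τ (α 0)) X) (Ioi 0) 0 := by
    refine HasDerivWithinAt.mono_of_mem_nhdsWithin ?_
      (Icc_mem_nhdsGT hε : Icc 0 ε ∈ 𝓝[>] 0)
    exact (hα.hasDerivWithinAt hτ h0).congr_deriv
      (congrArg (g.inner (α 0) (g.gradient τ (α 0))) hder)
  have hslope := (hasDerivWithinAt_iff_tendsto_slope' self_notMem_Ioi).1 hd
  have hnear : ∀ᶠ t in 𝓝[>] (0 : ℝ), α t ∈ U ∩ U' :=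
    ((hα.2.1.continuousOn 0 h0).mono_of_mem_nhdsWithin
      (Icc_mem_nhdsGT hε : Icc 0 ε ∈ 𝓝[>] 0)).eventually_mem hqU
  -- The product is the limit of the slopes of `τ ∘ α`, and the chart moves by exactly `t * ‖w‖` in
  -- time `t`.
  have hlow : C / K * ‖w‖ ≤ g.inner (α 0) (g.gradient τ (α 0)) X := by
    refine ge_of_tendsto hslope ?_
    filter_upwards [hnear, Ioc_mem_nhdsGT hε] with t ht htε
    have h1 := h (α 0) (mem_of_mem_nhds hqU).1 (α t) ht.1
      (Or.inr ⟨α, 0, t, ⟨1, fun i ↦ if i = 0 then 0 else t, one_pos, by simp, by simp,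
        fun i hi ↦ by
          obtain rfl : i = 0 := by omega
          simpa using hα.mono le_rfl htε.1 htε.2⟩, rfl, rfl⟩)
    obtain ⟨h2, h3⟩ := hK (α 0) (mem_of_mem_nhds hqU).2 (α t) ht.2
    have h4 : t * ‖w‖ ≤ K * (riemannianEDist (𝓡 (n + 1)) (α 0) (α t)).toReal := by
      have h5 := ENNReal.toReal_mono (ENNReal.mul_ne_top ENNReal.coe_ne_top h2.ne) h3
      rw [edist_dist, ENNReal.toReal_ofReal dist_nonneg, ENNReal.toReal_mul,
        hseg t ⟨htε.1.le, htε.2⟩, dist_self_add_right, norm_smul, Real.norm_of_nonneg htε.1.le] at h5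
      exact h5
    rw [slope_def_field, sub_zero, le_div_iff₀ htε.1]
    refine le_trans ?_ h1
    have hK' : (0 : ℝ) < K := K_pos
    rw [div_mul_eq_mul_div, div_mul_eq_mul_div, div_le_iff₀ hK']
    nlinarith
  refine le_trans ?_ hlow
  have hK' : (0 : ℝ) < K := K_pos
  have hL' : (0 : ℝ) < L := L_pos
  calc C / (K * L) * ‖X‖ ≤ C / (K * L) * (L * ‖w‖) := by
        gcongr
        exact hqL X
    _ = C / K * ‖w‖ := by field_simp

/-- The chart distance scaled by `C / K` is at most `C` times the Riemannian distance, and it is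
definite because the chart is injective. -/
theorem locallyAntiLipschitz_of_riemannianEDist {g : Spacetime n M} {τ : M → ℝ}
    (h : ∀ p : M, ∃ U ∈ 𝓝 p, ∃ C : ℝ, 0 < C ∧ ∀ x ∈ U, ∀ y ∈ U, g.CausallyPrecedes x y →
      C * (riemannianEDist (𝓡 (n + 1)) x y).toReal ≤ τ y - τ x) :
    g.LocallyAntiLipschitz τ := by
  intro p
  obtain ⟨U, hU, C, hC, hUC⟩ := h p
  obtain ⟨K, K_pos, U', hU', hsource, hK⟩ :=
    exists_edist_extChartAt_le_mul_riemannianEDist (I := 𝓡 (n + 1)) p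
  have hK' : (0 : ℝ) < K := K_pos
  refine ⟨U ∩ U', inter_mem hU hU', MetricSpace.induced
    (fun x : ↑(U ∩ U') ↦ (C / K) • extChartAt (𝓡 (n + 1)) p x) ?_ inferInstance,
    fun x y hxy ↦ ?_⟩
  · intro x y hxy
    refine Subtype.ext ((extChartAt (𝓡 (n + 1)) p).injOn (hsource x.2.2) (hsource y.2.2) ?_)
    exact smul_right_injective _ (div_pos hC hK').ne' hxy
  · refine le_trans ?_ (hUC x x.2.1 y y.2.1 hxy)
    change dist ((C / K : ℝ) • extChartAt (𝓡 (n + 1)) p x)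
      ((C / K : ℝ) • extChartAt (𝓡 (n + 1)) p y) ≤ _
    obtain ⟨h2, h3⟩ := hK x x.2.2 y y.2.2
    have h5 := ENNReal.toReal_mono (ENNReal.mul_ne_top ENNReal.coe_ne_top h2.ne) h3
    rw [edist_dist, ENNReal.toReal_ofReal dist_nonneg, ENNReal.toReal_mul,
      ENNReal.coe_toReal] at h5
    rw [dist_smul₀, Real.norm_of_nonneg (by positivity), div_mul_eq_mul_div, div_le_iff₀ hK']
    nlinarith

end Riemannian

end Spacetime

end NullDistance

/-! ### The equivalence and its consequences -/

theorem mainTheorem12 (n : ℕ) (M : Type*) [TopologicalSpace M] [T2Space M]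
    [SecondCountableTopology M] [ChartedSpace (EuclideanSpace ℝ (Fin (n + 1))) M]
    [IsManifold (𝓡 (n + 1)) ∞ M]
    (g : NullDistance.Spacetime n M) (h : NullDistance.RiemMetric n M)
    (τ : M → ℝ) (hτ : MDifferentiable (𝓡 (n + 1)) 𝓘(ℝ, ℝ) τ) :
    let condA : Prop := ∀ p : M, ∃ U ∈ 𝓝 p, ∃ C : ℝ, 0 < C ∧
      ∀ q ∈ U, ∀ X ∈ g.future q,
        g.inner q (g.gradient τ q) X ≥ C * NullDistance.hnorm h q X
    let condB : Prop := ∀ p : M, ∃ U ∈ 𝓝 p, ∃ C : ℝ, 0 < C ∧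
      ∀ x ∈ U, ∀ y ∈ U, g.CausallyPrecedes x y →
        τ y - τ x ≥ C * NullDistance.hdist h x y
    (condA ↔ condB) ∧
    (condA ∨ condB →
      g.LocallyAntiLipschitz τ ∧
      g.IsTimeFunction τ ∧
      (∀ p : M, g.IsPastTimelike p (g.gradient τ p)) ∧
      (∀ p : M, ∃ U ∈ 𝓝 p, ∃ C : ℝ, 0 < C ∧
        ∀ q ∈ U, C ≤ g.gnorm q (g.gradient τ q))) := by
  intro condA condB
  -- Together with the Hausdorff property this supplies `RegularSpace M`.
  have : LocallyCompactSpace M := Manifold.locallyCompact_of_finiteDimensional (𝓡 (n + 1))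
  let : RiemannianBundle (fun p : M ↦ TangentSpace (𝓡 (n + 1)) p) := ⟨h.toRiemannianMetric⟩
  have : IsContinuousRiemannianBundle (EuclideanSpace ℝ (Fin (n + 1)))
      (fun p : M ↦ TangentSpace (𝓡 (n + 1)) p) :=
    ⟨h.inner, h.contMDiff.continuous, fun _ _ _ ↦ rfl⟩
  -- The norm of the Riemannian bundle agrees with `hnorm h` by definition.
  have hA : condA → ∀ p : M, ∃ U ∈ 𝓝 p, ∃ C : ℝ, 0 < C ∧ ∀ q ∈ U, ∀ X ∈ g.future q,
      C * ‖X‖ ≤ g.inner q (g.gradient τ q) X := id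
  have hA' : (∀ p : M, ∃ U ∈ 𝓝 p, ∃ C : ℝ, 0 < C ∧ ∀ q ∈ U, ∀ X ∈ g.future q,
      C * ‖X‖ ≤ g.inner q (g.gradient τ q) X) → condA := id
  have hpos : condA → ∀ q, ∀ X ∈ g.future q, 0 < g.inner q (g.gradient τ q) X := by
    intro hcond q X hX
    obtain ⟨U, hU, C, hC, hUC⟩ := hA hcond q
    exact (mul_pos hC (norm_pos_iff.2 (g.ne_zero_of_mem_future hX))).trans_le
      (hUC q (mem_of_mem_nhds hU) X hX)
  have hAB : condA → condB := by
    intro hcond p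
    obtain ⟨U, hU, C, hC, hUC⟩ := hA hcond p
    obtain ⟨W, hW, hWC⟩ :=
      NullDistance.Spacetime.exists_forall_causallyPrecedes_le hτ (hpos hcond) hU hC hUC
    exact ⟨W, hW, C, hC, hWC⟩
  have hBA : condB → condA := by
    intro hcond
    refine hA' fun p ↦ ?_
    obtain ⟨U, hU, C, hC, hUC⟩ := hcond p
    exact NullDistance.Spacetime.exists_forall_future_le hτ hU hC hUC
  refine ⟨⟨hAB, hBA⟩, fun hcond ↦ ?_⟩
  have ha : condA := hcond.elim id hBA
  have hpast : ∀ p : M, g.IsPastTimelike p (g.gradient τ p) := fun p ↦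
    g.isPastTimelike_of_forall_pos (hpos ha p)
  refine ⟨NullDistance.Spacetime.locallyAntiLipschitz_of_riemannianEDist (hAB ha),
    ⟨hτ.continuous, NullDistance.Spacetime.isGeneralizedTimeFunction_of_forall_pos hτ (hpos ha)⟩,
    hpast, fun p ↦ ?_⟩
  obtain ⟨U, hU, C, hC, hUC⟩ := hA ha p
  exact NullDistance.Spacetime.exists_forall_le_gnorm_gradient hpast hU hC hUC
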